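/- **Setting.** A network consists of a finite set of $n$ nodes, two disjoint finite sets of directed edges, $E^0$ (known) and $E^\Delta$ (unknown), and sets $\mathcal B$ of $n_B$ excited nodes and $\mathcal C$ of $n_C$ measured nodes. All transfer functions are taken at a single frequency, i.e. they are complex numbers. A network matrix is $G=G^0+G^\Delta\in\mathbb C^{n\times n}$, where $G^0$ is supported on $E^0$ (known entries), $G^\Delta$ is supported on $E^\Delta$ (unknown entries), and an edge $j\to i$ carries the entry $G_{ij}$. $G$ is well-posed if $I-G$ is invertible, and then $T(G)=(I-G)^{-1}$. $B\in\{0,1\}^{n\times n_B}$ and $C\in\{0,1\}^{n_C\times n}$ are the binary matrices selecting the excited and the measured nodes. A property holds for almost all values of some complex parameters if it holds outside the zero set of a nonzero polynomial in them. For given known entries $G^0$, the network is *generically decoupled-identifiable* if, for almost all pairs $(G,G')$ of network matrices with these known entries (i.e. for almost all values of the unknown entries of $G$ and of $G'$, chosen independently), $G$ and $G'$ are well-posed and, for every $\Delta\in\mathbb C^{n\times n}$ supported on $E^\Delta$, $C\,T(G)\,\Delta\,T(G')\,B=0$ implies $\Delta=0$. Paths are directed paths in the graph with edge set $E^0\cup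 E^\Delta$; one-vertex paths are allowed. Paths are vertex-disjoint if no two of them share a vertex. Assume $|E^\Delta|=n_Bn_C$. Consider the following properties of an excitation assignation $\sigma_B:E^\Delta\to\mathcal B$ (resp. a measurement assignation $\sigma_C:E^\Delta\to\mathcal C$): (a) exactly $n_C$ (resp. $n_B$) unknown edges are assigned to each excitation $b\in\mathcal B$ (resp. measurement $c\in\mathcal C$); (b) for each $\alpha\in E^\Delta$ there is a path from $\sigma_B(\alpha)$ to the start node of $\alpha$ (resp. from the end node of $\alpha$ to $\sigma_C(\alpha)$); (c) for each $b\in\mathcal B$ there are $n_C$ vertex-disjoint paths from end nodes of the edges assigned to $b$ to nodes of $\mathcal C$ (resp. for each $c\in\mathcal C$ there are $n_B$ vertex-disjoint paths from nodes of $\mathcal B$ to start nodes of the edges assigned to $c$). **Lemma.** 1. If, for some values of the known entries $G^0$, the network is generically decoupled-identifiable, then there is at least one $\sigma_B$ satisfying (a), (b), (c), and at least one $\sigma_C$ satisfying the respective (a), (b), (c). 2. If there is exactly one $\sigma_B$ satisfying (a), (b), (c), then for almost all values of the known entries $G^0$ the network is generically decoupled-identifiable. Likewise, if there is exactly one $\sigma_C$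 satisfying the respective (a), (b), (c), then for almost all values of the known entries $G^0$ the network is generically decoupled-identifiable. -/

import Mathlib

/-!
Networks at a single frequency: transfer functions are complex numbers.  The ordered pair `(j, i)`
stands for the directed edge from node `j` to node `i`, which carries the matrix entry `G i j`.
-/

open Matrix

/-- A property of the parameters `x ∈ ℂ^ι` holds *for almost all* `x`: it holds at every `x` outside
the zero set of some nonzero polynomial (a proper algebraic subset). -/
def ForAlmostAll {ι : Type*} (P : (ι → ℂ) → Prop) : Prop :=
  ∃ p : MvPolynomial ι ℂ, p ≠ 0 ∧ ∀ x : ι → ℂ, MvPolynomial.eval x p ≠ 0 → P x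

/-- The data of a network on the nodes `V`: the edges carrying a known transfer function, those
carrying an unknown one, the excited nodes and the measured nodes. -/
structure Network (V : Type*) where
  known : Finset (V × V)
  unknown : Finset (V × V)
  disjoint_known_unknown : Disjoint known unknown
  excited : Finset V
  measured : Finset V

/-- The matrix supported on the set of edges `S`, with the prescribed entries. -/
def edgeMatrix {V : Type*} [DecidableEq V] (S : Finset (V × V)) (x : S → ℂ) : Matrix V V ℂ :=
  Matrix.of fun i j => if h : (j, i) ∈ S then x ⟨(j, i), h⟩ else 0

/-- `T(G) = (I - G)⁻¹`; meaningful only when `I - G` is invertible. -/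
noncomputable def closedLoop {V : Type*} [Fintype V] [DecidableEq V] (G : Matrix V V ℂ) :
    Matrix V V ℂ :=
  (1 - G)⁻¹

/-- Well-posedness at the considered frequency. -/
def WellPosed {V : Type*} [Fintype V] [DecidableEq V] (G : Matrix V V ℂ) : Prop :=
  IsUnit (1 - G)

/-- `p` lists the successive vertices of a directed path (without repeated vertex) from `u` to `v`.
The one-vertex path from `u` to `u` is allowed. -/
def IsDirectedPath {V : Type*} (adj : V → V → Prop) (p : List V) (u v : V) : Prop :=
  p.IsChain adj ∧ p.Nodup ∧ p.head? = some u ∧ p.getLast? = some v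

/-- One can route `k` vertex-disjoint directed paths from the set `J` to the set `I`. -/
def HasVertexDisjointPaths {V : Type*} (adj : V → V → Prop) (J I : Set V) (k : ℕ) : Prop :=
  ∃ P : Fin k → List V,
    (∀ m, ∃ u ∈ J, ∃ v ∈ I, IsDirectedPath adj (P m) u v) ∧
    Pairwise fun m m' => List.Disjoint (P m) (P m')

namespace Network

variable {V : Type*} (N : Network V)

/-- Adjacency in the network graph, whose edges are the known and the unknown ones. -/
def Adj (u v : V) : Prop := (u, v) ∈ N.known ∨ (u, v) ∈ N.unknown

section Identifiability

variable [Fintype V] [DecidableEq V]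

/-- The network matrix `G = G⁰ + G^Δ` with known entries `g₀` and unknown entries `g`. -/
def netMatrix (g₀ : N.known → ℂ) (g : N.unknown → ℂ) : Matrix V V ℂ :=
  edgeMatrix N.known g₀ + edgeMatrix N.unknown g

/-- The excitation matrix: one column per excited node, selecting this node. -/
def excitationMatrix : Matrix V N.excited ℂ :=
  Matrix.of fun i b => if i = (b : V) then 1 else 0

/-- The measurement matrix: one row per measured node, selecting this node. -/
def measurementMatrix : Matrix N.measured V ℂ :=
  Matrix.of fun c i => if i = (c : V) then 1 else 0

/-- Decoupled identifiability at a pair `(G, G')` of well-posed network matrices. -/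
def DecoupledIdentifiableAt (G G' : Matrix V V ℂ) : Prop :=
  WellPosed G ∧ WellPosed G' ∧
    ∀ Δ : Matrix V V ℂ, (∀ i j, (j, i) ∉ N.unknown → Δ i j = 0) →
      N.measurementMatrix * closedLoop G * Δ * closedLoop G' * N.excitationMatrix = 0 → Δ = 0

/-- Generic decoupled identifiability of the network with known transfer functions `g₀`:
decoupled identifiability at `(G, G')` for almost all pairs of network matrices `G`, `G'` with
these known entries, i.e. for almost all values of the unknown entries of `G` and of `G'`. -/
def GenericallyDecoupledIdentifiable (g₀ : N.known → ℂ) : Prop :=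
  ForAlmostAll fun x : N.unknown ⊕ N.unknown → ℂ =>
    N.DecoupledIdentifiableAt (N.netMatrix g₀ fun α => x (Sum.inl α))
      (N.netMatrix g₀ fun α => x (Sum.inr α))

end Identifiability

/-- The excitation assignations considered: (a) `n_C` unknown edges are assigned to each
excitation; (b) there is a path from the excitation assigned to `α` to the start node of `α`;
(c) for each excitation there are `n_C` vertex-disjoint paths from the end nodes of the edges
assigned to it to the measured nodes. -/
structure IsExcitationAssignation (σ : N.unknown → N.excited) : Prop where
  card_fiber : ∀ b, Nat.card {α // σ α = b} = N.measured.card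
  connected : ∀ α, ∃ p, IsDirectedPath N.Adj p (σ α : V) α.1.1
  disjoint_paths : ∀ b, HasVertexDisjointPaths N.Adj
    {v | ∃ α, σ α = b ∧ α.1.2 = v} {v | v ∈ N.measured} N.measured.card

/-- The measurement assignations considered: (a) `n_B` unknown edges are assigned to each
measurement; (b) there is a path from the end node of `α` to the measurement assigned to `α`;
(c) for each measurement there are `n_B` vertex-disjoint paths from the excited nodes to the start
nodes of the edges assigned to it. -/
structure IsMeasurementAssignation (σ : N.unknown → N.measured) : Prop where
  card_fiber : ∀ c, Nat.card {α // σ α = c} = N.excited.card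
  connected : ∀ α, ∃ p, IsDirectedPath N.Adj p α.1.2 (σ α : V)
  disjoint_paths : ∀ c, HasVertexDisjointPaths N.Adj
    {v | v ∈ N.excited} {v | ∃ α, σ α = c ∧ α.1.1 = v} N.excited.card

end Network

/-!
Decoupled identifiability at `(G, G')` is the injectivity of the linear map
`Δ ↦ C T(G) Δ T(G') B`, whose matrix has, in the row of the measurement `c` and the excitation `b`
and in the column of the unknown edge `α : j → i`, the entry `T(G) c i * T(G') j b`. As there are
`n_B n_C` unknown edges this matrix is square, and identifiability amounts to the nonvanishing of its
determinant (`Network.decoupledIdentifiableAt_iff`).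

Expanding the determinant along the blocks of rows with a common `b` (`det_columnKronecker`) writes
it as a sum over the maps `σ` from unknown edges to excitations. The term of `σ` vanishes unless `σ`
assigns `n_C` edges to each excitation, and it is then, up to sign, the product of the entries
`T(G') j (σ α)` and, over the excitations `b`, of the minors of `T(G)` with rows the measured nodes
and columns the end nodes of the edges assigned to `b`. Grouping the rows by `c` instead yields
the corresponding sum over measurement assignations.

A minor of `T(G) = (I - G)⁻¹` is nonzero only if there are vertex-disjoint paths from its columns to
its rows (`hasVertexDisjointPaths_of_minor_ne_zero`): up to a nonzero factor it is the determinant of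
`I - G` bordered by unit vectors, and a permutation with a nonzero term in this determinant has
cycles through the border that trace such paths. Conversely, if there are such paths, then the
bordered matrix of the union of the paths is nonsingular
(`det_borderedMatrix_pathMatrix_ne_zero`), so that the minor is generically nonzero. A single entry
of `T(G)` is a minor of size one, to which a single path corresponds.

Hence a nonzero term of the expansion comes from an admissible assignation, which gives necessity.
If there is only one admissible assignation, then all other terms vanish at every pair of well-posed
network matrices, while its own term is generically nonzero, which gives sufficiency; the passage
from almost all triples of known and unknown entries to almost all known entries is
`ForAlmostAll.curry`.
-/

/-! ### Properties holding for almost all parameters -/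

section Genericity

variable {ι κ : Type*}

theorem MvPolynomial.exists_eval_ne_zero {p : MvPolynomial ι ℂ} (hp : p ≠ 0) :
    ∃ x : ι → ℂ, MvPolynomial.eval x p ≠ 0 := by
  by_contra! h
  exact hp (MvPolynomial.funext fun x => by simpa using h x)

namespace ForAlmostAll

theorem exists_point {P : (ι → ℂ) → Prop} (h : ForAlmostAll P) : ∃ x, P x := by
  obtain ⟨p, hp, hP⟩ := h
  obtain ⟨x, hx⟩ := MvPolynomial.exists_eval_ne_zero hp
  exact ⟨x, hP x hx⟩

theorem mono {P Q : (ι → ℂ) → Prop} (h : ForAlmostAll P) (hPQ : ∀ x, P x → Q x) :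
    ForAlmostAll Q := by
  obtain ⟨p, hp, hP⟩ := h
  exact ⟨p, hp, fun x hx => hPQ x (hP x hx)⟩

theorem and {P Q : (ι → ℂ) → Prop} (hP : ForAlmostAll P) (hQ : ForAlmostAll Q) :
    ForAlmostAll fun x => P x ∧ Q x := by
  obtain ⟨p, hp, hP⟩ := hP
  obtain ⟨q, hq, hQ⟩ := hQ
  refine ⟨p * q, mul_ne_zero hp hq, fun x hx => ?_⟩
  rw [map_mul] at hx
  exact ⟨hP x (left_ne_zero_of_mul hx), hQ x (right_ne_zero_of_mul hx)⟩

theorem forall_fintype {β : Type*} [Fintype β] {P : β → (ι → ℂ) → Prop}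
    (h : ∀ b, ForAlmostAll (P b)) : ForAlmostAll fun x => ∀ b, P b x := by
  choose p hp hP using h
  refine ⟨∏ b, p b, Finset.prod_ne_zero_iff.2 fun b _ => hp b, fun x hx b => hP b x ?_⟩
  rw [map_prod] at hx
  exact Finset.prod_ne_zero_iff.1 hx b (Finset.mem_univ b)

theorem comp_injective {P : (ι → ℂ) → Prop} (h : ForAlmostAll P) {f : ι → κ}
    (hf : Function.Injective f) : ForAlmostAll fun x : κ → ℂ => P (x ∘ f) := by
  obtain ⟨p, hp, hP⟩ := h
  refine ⟨MvPolynomial.rename f p, fun h0 => hp ?_, fun x hx => hP _ ?_⟩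
  · exact MvPolynomial.rename_injective f hf (by rw [h0, map_zero])
  · rwa [MvPolynomial.eval_rename] at hx

/-- A property of almost all `(x, y)` holds, for almost all `x`, for almost all `y`. -/
theorem curry {P : (ι ⊕ κ → ℂ) → Prop} (h : ForAlmostAll P) :
    ForAlmostAll fun x : ι → ℂ => ForAlmostAll fun y : κ → ℂ => P (Sum.elim x y) := by
  obtain ⟨p, hp, hP⟩ := h
  obtain ⟨z, hz⟩ := MvPolynomial.exists_eval_ne_zero hp
  have key₁ : ∀ x : ι → ℂ, MvPolynomial.eval x (MvPolynomial.bind₁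
      (Sum.elim MvPolynomial.X fun k => MvPolynomial.C (z (Sum.inr k))) p) =
      MvPolynomial.eval (Sum.elim x (z ∘ Sum.inr)) p := fun x => by
    rw [MvPolynomial.eval, MvPolynomial.eval₂Hom_bind₁]
    congr 2
    ext (i | k) <;> simp
  have key₂ : ∀ (x : ι → ℂ) (y : κ → ℂ), MvPolynomial.eval y (MvPolynomial.bind₁
      (Sum.elim (fun i => MvPolynomial.C (x i)) MvPolynomial.X) p) =
      MvPolynomial.eval (Sum.elim x y) p := fun x y => by
    rw [MvPolynomial.eval, MvPolynomial.eval₂Hom_bind₁]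
    congr 2
    ext (i | k) <;> simp
  -- Both polynomials are nonzero because they do not vanish at the matching part of `z`.
  refine ⟨MvPolynomial.bind₁ (Sum.elim MvPolynomial.X fun k => MvPolynomial.C (z (Sum.inr k))) p,
    fun h0 => hz ?_, fun x hx => ⟨MvPolynomial.bind₁
      (Sum.elim (fun i => MvPolynomial.C (x i)) MvPolynomial.X) p, fun h0 => ?_, fun y hy => ?_⟩⟩
  · have := key₁ (z ∘ Sum.inl)
    rw [h0, map_zero, Sum.elim_comp_inl_inr] at this
    exact this.symm
  · rw [key₁, ← key₂, h0, map_zero] at hx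
    exact hx rfl
  · rw [key₂] at hy
    exact hP _ hy

/-- A determinant with polynomial entries that is nonzero somewhere is nonzero almost
everywhere. -/
theorem det_ne_zero {n : Type*} [Fintype n] [DecidableEq n] {F : (ι → ℂ) → Matrix n n ℂ}
    (hF : ∀ i j, ∃ p : MvPolynomial ι ℂ, ∀ x, MvPolynomial.eval x p = F x i j)
    {x₀ : ι → ℂ} (hx₀ : (F x₀).det ≠ 0) : ForAlmostAll fun x => (F x).det ≠ 0 := by
  choose p hp using hF
  have key : ∀ x, MvPolynomial.eval x (Matrix.of p).det = (F x).det := fun x => by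
    rw [RingHom.map_det]
    congr 1
    ext i j
    exact hp i j x
  refine ⟨(Matrix.of p).det, fun h0 => hx₀ ?_, fun x hx => ?_⟩
  · rw [← key, h0, map_zero]
  · rwa [key] at hx

end ForAlmostAll

end Genericity

/-! ### Laplace expansion of a column-wise Kronecker product -/

section Expansion

variable {Λ I J : Type*} [Fintype Λ] [DecidableEq Λ]

theorem Matrix.exists_perm_of_det_ne_zero {M : Matrix Λ Λ ℂ} (h : M.det ≠ 0) :
    ∃ π : Equiv.Perm Λ, ∀ x, M (π x) x ≠ 0 := by
  rw [Matrix.det_apply] at h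
  obtain ⟨π, -, hπ⟩ := Finset.exists_ne_zero_of_sum_ne_zero h
  refine ⟨π, fun x hx => hπ ?_⟩
  rw [Finset.prod_eq_zero (f := fun i => M (π i) i) (Finset.mem_univ x) hx, smul_zero]

/-- The column-wise Kronecker product of `A` and `D`, its rows being indexed by `Λ` through `e`. -/
def columnKronecker (A : I → Λ → ℂ) (D : Λ → J → ℂ) (e : Λ ≃ I × J) : Matrix Λ Λ ℂ :=
  Matrix.of fun l α => A (e l).1 α * D α (e l).2

/-- The matrix keeping, in each column `α`, only the entries of `A` placed in the block of rows
`σ α`. -/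
def columnSelect [DecidableEq J] (A : I → Λ → ℂ) (e : Λ ≃ I × J) (σ : Λ → J) : Matrix Λ Λ ℂ :=
  Matrix.of fun l α => if (e l).2 = σ α then A (e l).1 α else 0

/-- Expansion by multilinearity in the columns: `σ` chooses a block of rows for each column. -/
theorem det_columnKronecker [Fintype J] [DecidableEq J] (A : I → Λ → ℂ) (D : Λ → J → ℂ)
    (e : Λ ≃ I × J) : (columnKronecker A D e).det =
      ∑ σ : Λ → J, (∏ α, D α (σ α)) * (columnSelect A e σ).det := by
  simp_rw [Matrix.det_apply, Finset.mul_sum]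
  rw [Finset.sum_comm]
  refine Finset.sum_congr rfl fun π _ => ?_
  simp_rw [mul_smul_comm, ← Finset.smul_sum, ← Finset.prod_mul_distrib]
  congr 1
  trans ∏ α, ∑ b, D α b * if (e (π α)).2 = b then A (e (π α)).1 α else 0
  · refine Finset.prod_congr rfl fun α _ => ?_
    simp [columnKronecker, mul_comm]
  · exact Fintype.prod_sum fun α b => D α b * if (e (π α)).2 = b then A (e (π α)).1 α else 0

theorem exists_equiv_of_det_columnSelect_ne_zero [DecidableEq J] {A : I → Λ → ℂ} {e : Λ ≃ I × J}
    {σ : Λ → J} (h : (columnSelect A e σ).det ≠ 0) : ∃ τ : Λ ≃ I × J, ∀ α, (τ α).2 = σ α := by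
  obtain ⟨π, hπ⟩ := Matrix.exists_perm_of_det_ne_zero h
  refine ⟨π.trans e, fun α => ?_⟩
  by_contra hne
  exact hπ α (if_neg hne)

variable [Fintype I] [Fintype J] [DecidableEq I] [DecidableEq J]

/-- Once its columns are indexed by `I × J` compatibly with `σ`, `columnSelect` is block
diagonal. -/
theorem det_columnSelect_ne_zero_iff (A : I → Λ → ℂ) (e : Λ ≃ I × J) {σ : Λ → J}
    (τ : Λ ≃ I × J) (hτ : ∀ α, (τ α).2 = σ α) :
    (columnSelect A e σ).det ≠ 0 ↔
      ∀ b, (Matrix.of fun i i' => A i (τ.symm (i', b))).det ≠ 0 := by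
  have hblock : (columnSelect A e σ).submatrix e.symm τ.symm =
      Matrix.blockDiagonal fun b => Matrix.of fun i i' => A i (τ.symm (i', b)) := by
    ext ⟨i, b⟩ ⟨i', b'⟩
    simp only [columnSelect, Matrix.submatrix_apply, Matrix.of_apply, ← hτ,
      Equiv.apply_symm_apply, Matrix.blockDiagonal_apply]
    split_ifs with h
    · rw [h]
    · rfl
  rw [← isUnit_iff_ne_zero, ← Matrix.isUnit_iff_isUnit_det,
    ← Matrix.isUnit_submatrix_equiv e.symm τ.symm, hblock, Matrix.isUnit_iff_isUnit_det,
    Matrix.det_blockDiagonal, isUnit_iff_ne_zero, Finset.prod_ne_zero_iff]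
  simp

/-- The term of the assignation `fun α => (τ α).2` in the expansion of
`det (columnKronecker A D e)` is nonzero. The first components of `τ` only number the columns
within each block, so they do not affect the truth of this. -/
def IsNonvanishingTerm (A : I → Λ → ℂ) (D : Λ → J → ℂ) (τ : Λ ≃ I × J) : Prop :=
  (∀ α, D α (τ α).2 ≠ 0) ∧ ∀ b, (Matrix.of fun i i' => A i (τ.symm (i', b))).det ≠ 0

theorem exists_isNonvanishingTerm {A : I → Λ → ℂ} {D : Λ → J → ℂ} {e : Λ ≃ I × J} {σ : Λ → J}
    (h : (∏ α, D α (σ α)) * (columnSelect A e σ).det ≠ 0) :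
    ∃ τ, (∀ α, (τ α).2 = σ α) ∧ IsNonvanishingTerm A D τ := by
  have hdet := right_ne_zero_of_mul h
  obtain ⟨τ, hτ⟩ := exists_equiv_of_det_columnSelect_ne_zero hdet
  refine ⟨τ, hτ, fun α => ?_, (det_columnSelect_ne_zero_iff A e τ hτ).1 hdet⟩
  rw [hτ]
  exact Finset.prod_ne_zero_iff.1 (left_ne_zero_of_mul h) α (Finset.mem_univ α)

theorem exists_isNonvanishingTerm_of_det_ne_zero {A : I → Λ → ℂ} {D : Λ → J → ℂ}
    {e : Λ ≃ I × J} (h : (columnKronecker A D e).det ≠ 0) : ∃ τ, IsNonvanishingTerm A D τ := by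
  rw [det_columnKronecker] at h
  obtain ⟨σ, -, hσ⟩ := Finset.exists_ne_zero_of_sum_ne_zero h
  obtain ⟨τ, -, hτ⟩ := exists_isNonvanishingTerm hσ
  exact ⟨τ, hτ⟩

/-- If all nonvanishing terms lie over the same assignation, they cannot cancel. -/
theorem det_columnKronecker_ne_zero {A : I → Λ → ℂ} {D : Λ → J → ℂ} (e : Λ ≃ I × J)
    {τ : Λ ≃ I × J} (hτ : IsNonvanishingTerm A D τ)
    (huniq : ∀ τ', IsNonvanishingTerm A D τ' → ∀ α, (τ' α).2 = (τ α).2) :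
    (columnKronecker A D e).det ≠ 0 := by
  rw [det_columnKronecker, Finset.sum_eq_single fun α => (τ α).2]
  · exact mul_ne_zero (Finset.prod_ne_zero_iff.2 fun α _ => hτ.1 α)
      ((det_columnSelect_ne_zero_iff A e τ fun _ => rfl).2 hτ.2)
  · intro σ _ hne
    by_contra h0
    obtain ⟨τ', hτ', hterm⟩ := exists_isNonvanishingTerm h0
    exact hne (funext fun α => (hτ' α).symm.trans (huniq τ' hterm α))
  · simp

end Expansion

/-! ### Minors of the closed-loop matrix and vertex-disjoint paths -/

section Minors

theorem index_unique_of_disjoint {V : Type*} {k : ℕ} {P : Fin k → List V}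
    (hnodup : ∀ m, (P m).Nodup) (hdisj : Pairwise fun m m' => List.Disjoint (P m) (P m'))
    {m m' : Fin k} {i j : ℕ} {v : V} (h : (P m)[i]? = some v) (h' : (P m')[j]? = some v) :
    m = m' ∧ i = j := by
  obtain rfl : m = m' := by
    by_contra hne
    exact hdisj hne (List.mem_of_getElem? h) (List.mem_of_getElem? h')
  obtain ⟨hi, -⟩ := List.getElem?_eq_some_iff.1 h
  exact ⟨rfl, (List.getElem?_inj hi (hnodup m)).1 (h.trans h'.symm)⟩

section PathsOfPerm

variable {V K : Type*} [Fintype V] [Fintype K] {π : Equiv.Perm (V ⊕ K)}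

theorem Equiv.Perm.exists_pow_isRight (π : Equiv.Perm (V ⊕ K)) (k : K) :
    ∃ n, 0 < n ∧ ((π ^ n) (Sum.inr k)).isRight := by
  classical
  exact ⟨orderOf π, orderOf_pos π, by simp [pow_orderOf_eq_one]⟩

/-- The time of first return to `K` of the orbit of `k : K` under a permutation of `V ⊕ K`. -/
def returnTime (π : Equiv.Perm (V ⊕ K)) (k : K) : ℕ :=
  Nat.find (π.exists_pow_isRight k)

theorem returnTime_pos (k : K) : 0 < returnTime π k :=
  (Nat.find_spec (π.exists_pow_isRight k)).1

theorem isRight_returnTime (k : K) : ((π ^ returnTime π k) (Sum.inr k)).isRight :=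
  (Nat.find_spec (π.exists_pow_isRight k)).2

theorem not_isRight_of_lt_returnTime {k : K} {n : ℕ} (hn : 0 < n) (h : n < returnTime π k) :
    ¬ ((π ^ n) (Sum.inr k)).isRight :=
  fun h' => Nat.find_min (π.exists_pow_isRight k) h ⟨hn, h'⟩

/-- The excursions of the orbits of `π` out of `K` do not meet. -/
theorem excursion_injective {k k' : K} {i j : ℕ} (hi : i < returnTime π k)
    (hj : j < returnTime π k') (h : (π ^ i) (Sum.inr k) = (π ^ j) (Sum.inr k')) :
    k = k' ∧ i = j := by
  wlog hij : i ≤ j generalizing k k' i j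
  · obtain ⟨h₁, h₂⟩ := this hj hi h.symm (by omega)
    exact ⟨h₁.symm, h₂.symm⟩
  obtain ⟨d, rfl⟩ := Nat.exists_eq_add_of_le hij
  rw [pow_add, Equiv.Perm.mul_apply] at h
  have h' := (π ^ i).injective h
  rcases Nat.eq_zero_or_pos d with rfl | hd
  · simpa using h'
  · exact absurd (by rw [← h']; rfl) (not_isRight_of_lt_returnTime hd (by omega : d < _))

theorem hasVertexDisjointPaths_of_perm {adj : V → V → Prop} {start fin : K → V}
    (hstart : ∀ k, π (Sum.inr k) = Sum.inl (start k))
    (hadj : ∀ v w, π (Sum.inl v) = Sum.inl w → v = w ∨ adj v w)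
    (hfin : ∀ v k, π (Sum.inl v) = Sum.inr k → v = fin k) :
    HasVertexDisjointPaths adj (Set.range start) (Set.range fin) (Fintype.card K) := by
  -- The orbit of `k`, read in `V`; the value on `K` is irrelevant.
  let q : K → ℕ → V := fun k i => Sum.elim id start ((π ^ (i + 1)) (Sum.inr k))
  have hq : ∀ k i, i + 1 < returnTime π k → (π ^ (i + 1)) (Sum.inr k) = Sum.inl (q k i) := by
    intro k i hi
    have := not_isRight_of_lt_returnTime (Nat.succ_pos i) hi
    simp only [q]
    cases hx : (π ^ (i + 1)) (Sum.inr k) with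
    | inl v => rfl
    | inr k' => simp [hx] at this
  have hstep : ∀ k i, (π ^ (i + 1)) (Sum.inr k) = π ((π ^ i) (Sum.inr k)) := fun k i => by
    rw [pow_succ', Equiv.Perm.mul_apply]
  have hinj : ∀ k k' i j, i + 1 < returnTime π k → j + 1 < returnTime π k' →
      q k i = q k' j → k = k' ∧ i = j := by
    intro k k' i j hi hj h
    have := excursion_injective hi hj (by rw [hq k i hi, hq k' j hj, h])
    exact ⟨this.1, by omega⟩
  have htwo : ∀ k, 2 ≤ returnTime π k := by
    intro k
    have h0 : 0 < returnTime π k := returnTime_pos k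
    by_contra hlt
    have h1 : returnTime π k = 1 := by omega
    have := isRight_returnTime (π := π) k
    rw [h1, pow_one, hstart] at this
    simp at this
  let P : K → List V := fun k => (List.range (returnTime π k - 1)).map (q k)
  have hmem : ∀ k v, v ∈ P k ↔ ∃ i, i + 1 < returnTime π k ∧ q k i = v := by
    intro k v
    simp only [P, List.mem_map, List.mem_range]
    exact exists_congr fun i => and_congr_left fun _ => by omega
  have hpath : ∀ k, ∃ u ∈ Set.range start, ∃ v ∈ Set.range fin,
      IsDirectedPath adj (P k) u v := by
    intro k
    have h2 := htwo k
    obtain ⟨m, hm⟩ : ∃ m, returnTime π k = m + 2 := ⟨returnTime π k - 2, by omega⟩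
    have hlast : ∃ k', q k m = fin k' := by
      have hr := isRight_returnTime (π := π) k
      rw [hm, hstep, hq k m (by omega)] at hr
      obtain ⟨k', hk'⟩ := Sum.isRight_iff.1 hr
      exact ⟨k', hfin _ _ hk'⟩
    refine ⟨start k, ⟨k, rfl⟩, q k m, ?_, ?_, ?_, ?_, ?_⟩
    · obtain ⟨k', hk'⟩ := hlast
      exact ⟨k', hk'.symm⟩
    · rw [List.isChain_iff_getElem]
      intro i hi
      simp only [P, List.length_map, List.length_range] at hi
      simp only [P, List.getElem_map, List.getElem_range]
      refine (hadj _ _ ?_).resolve_left fun heq => ?_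
      · rw [← hq k i (by omega), ← hq k (i + 1) (by omega), hstep k (i + 1)]
      · have := (hinj k k i (i + 1) (by omega) (by omega) heq).2
        omega
    · refine List.Nodup.map_on ?_ List.nodup_range
      intro i hi j hj h
      rw [List.mem_range] at hi hj
      exact (hinj k k i j (by omega) (by omega) h).2
    · simp [P, hm, q, hstart, List.range_succ_eq_map]
    · simp [P, hm, List.range_succ]
  refine ⟨fun m => P ((Fintype.equivFin K).symm m), fun m => hpath _, fun m m' hne v hv hv' => ?_⟩
  obtain ⟨i, hi, h⟩ := (hmem _ _).1 hv
  obtain ⟨j, hj, h'⟩ := (hmem _ _).1 hv'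
  exact hne ((Fintype.equivFin K).symm.injective (hinj _ _ i j hi hj (h.trans h'.symm)).1)

end PathsOfPerm

variable {V : Type*} [Fintype V] [DecidableEq V] {K : Type*} [Fintype K] [DecidableEq K]

/-- The matrix `I - G` bordered by the columns of the unit vectors at the nodes `start k` and the
rows of the unit vectors at the nodes `fin k`. -/
def borderedMatrix (G : Matrix V V ℂ) (start fin : K → V) : Matrix (V ⊕ K) (V ⊕ K) ℂ :=
  Matrix.fromBlocks (1 - G) (Matrix.of fun v k => if v = start k then 1 else 0)
    (Matrix.of fun k v => if v = fin k then 1 else 0) 0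

/-- The minor of `T(G)` with columns `start` and rows `fin`. -/
noncomputable def closedLoopMinor (G : Matrix V V ℂ) (start fin : K → V) : ℂ :=
  (Matrix.of fun k k' => closedLoop G (fin k) (start k')).det

/-- The Schur complement of `I - G` in the bordered matrix is the opposite of the submatrix of
`T(G)`. -/
theorem closedLoopMinor_ne_zero_iff {G : Matrix V V ℂ} (hG : WellPosed G) (start fin : K → V) :
    closedLoopMinor G start fin ≠ 0 ↔ (borderedMatrix G start fin).det ≠ 0 := by
  have hdet : IsUnit (1 - G).det := (Matrix.isUnit_iff_isUnit_det _).1 hG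
  let _ : Invertible (1 - G) := Matrix.invertibleOfIsUnitDet _ hdet
  have hsub : (0 : Matrix K K ℂ) - (Matrix.of fun k v => if v = fin k then (1 : ℂ) else 0) *
      ⅟(1 - G) * (Matrix.of fun v k => if v = start k then (1 : ℂ) else 0) =
      -(Matrix.of fun k k' => closedLoop G (fin k) (start k')) := by
    ext k k'
    simp [Matrix.mul_apply, closedLoop, Matrix.invOf_eq_nonsing_inv]
  rw [borderedMatrix, Matrix.det_fromBlocks₁₁, hsub, Matrix.det_neg, closedLoopMinor]
  simp [hdet.ne_zero]

/-- A nonzero minor of `T(G)` yields vertex-disjoint paths in any graph supporting `G`: they are the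
cycles through the border in a nonzero term of the determinant of the bordered matrix. -/
theorem hasVertexDisjointPaths_of_minor_ne_zero {G : Matrix V V ℂ} (hG : WellPosed G)
    {adj : V → V → Prop} (hadj : ∀ v w, G w v ≠ 0 → adj v w) {start fin : K → V}
    (h : closedLoopMinor G start fin ≠ 0) :
    HasVertexDisjointPaths adj (Set.range start) (Set.range fin) (Fintype.card K) := by
  obtain ⟨π, hπ⟩ := Matrix.exists_perm_of_det_ne_zero ((closedLoopMinor_ne_zero_iff hG _ _).1 h)
  refine hasVertexDisjointPaths_of_perm (π := π) ?_ ?_ ?_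
  · intro k
    have := hπ (Sum.inr k)
    cases hx : π (Sum.inr k) with
    | inl v =>
      rw [hx] at this
      by_contra hne
      exact this (by simpa [borderedMatrix] using fun h' => hne (by rw [h']))
    | inr k' => simp [hx, borderedMatrix] at this
  · intro v w hvw
    have := hπ (Sum.inl v)
    rw [hvw] at this
    by_contra! hne
    have h0 : G w v = 0 := by
      by_contra h0
      exact hne.2 (hadj v w h0)
    simp [borderedMatrix, h0, Matrix.one_apply_ne' hne.1] at this
  · intro v k hvk
    have := hπ (Sum.inl v)
    rw [hvk] at this
    by_contra hne
    simp [borderedMatrix, hne] at this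

open Classical in
/-- The adjacency matrix of the union of the paths `P m`. -/
noncomputable def pathMatrix {k : ℕ} (P : Fin k → List V) : Matrix V V ℂ :=
  Matrix.of fun w v => if ∃ m, ∃ i, (P m)[i]? = some v ∧ (P m)[i + 1]? = some w then 1 else 0

/-- For a family of disjoint paths joining `start` to `fin`, the bordered matrix of the union of the
paths is nonsingular: an element of its kernel is constant along each path, and vanishes at the
end. -/
theorem det_borderedMatrix_pathMatrix_ne_zero {adj : V → V → Prop} {start fin : K → V}
    {P : Fin (Fintype.card K) → List V}
    (hP : ∀ m, ∃ u ∈ Set.range start, ∃ v ∈ Set.range fin, IsDirectedPath adj (P m) u v)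
    (hdisj : Pairwise fun m m' => List.Disjoint (P m) (P m')) :
    (borderedMatrix (pathMatrix P) start fin).det ≠ 0 := by
  choose u hu v hv hpath using hP
  choose s hs using hu
  choose f hf using hv
  have hnodup := fun m => (hpath m).2.1
  have hidx := @index_unique_of_disjoint V _ P hnodup hdisj
  have hhead : ∀ m, (P m)[0]? = some (u m) := fun m => by
    rw [← (hpath m).2.2.1, List.head?_eq_getElem?]
  have hlast : ∀ m, (P m)[(P m).length - 1]? = some (v m) := fun m => by
    rw [← (hpath m).2.2.2, List.getLast?_eq_getElem?]
  have hsinj : Function.Injective s := fun m m' h => by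
    have hm := hhead m
    rw [← hs m, h, hs m'] at hm
    exact (hidx hm (hhead m')).1
  have hssurj : Function.Surjective s :=
    ((Fintype.bijective_iff_injective_and_card s).2 ⟨hsinj, by simp⟩).2
  intro hdet
  obtain ⟨x, hx0, hx⟩ := Matrix.exists_mulVec_eq_zero_iff.2 hdet
  apply hx0
  obtain ⟨y, z, rfl⟩ : ∃ y z, x = Sum.elim y z :=
    ⟨x ∘ Sum.inl, x ∘ Sum.inr, (Sum.elim_comp_inl_inr x).symm⟩
  have hrow : ∀ w, y w - ∑ a, pathMatrix P w a * y a +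
      ∑ k, (if w = start k then z k else 0) = 0 := by
    intro w
    have := congrFun hx (Sum.inl w)
    rw [borderedMatrix, Matrix.fromBlocks_mulVec, Sum.elim_inl, Sum.elim_comp_inl,
      Sum.elim_comp_inr, Matrix.sub_mulVec, Matrix.one_mulVec] at this
    simpa [Matrix.mulVec, dotProduct] using this
  have hend : ∀ k, y (fin k) = 0 := by
    intro k
    have := congrFun hx (Sum.inr k)
    simpa [borderedMatrix, Matrix.fromBlocks_mulVec, Matrix.mulVec, dotProduct] using this
  -- The first nodes of the paths exhaust the starting nodes, since there are as many paths as
  -- indices.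
  have hnostart : ∀ w, (∀ m, w ≠ u m) → ∑ k, (if w = start k then z k else 0) = 0 := by
    intro w hw
    refine Finset.sum_eq_zero fun k _ => if_neg fun h => ?_
    obtain ⟨m, rfl⟩ := hssurj k
    exact hw m (h.trans (hs m))
  have hsucc : ∀ m (i : ℕ) a w, (P m)[i]? = some a → (P m)[i + 1]? = some w → y w = y a := by
    intro m i a w ha hw
    have h1 : ∑ a', pathMatrix P w a' * y a' = y a := by
      rw [Finset.sum_eq_single a]
      · rw [pathMatrix, Matrix.of_apply, if_pos ⟨m, i, ha, hw⟩, one_mul]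
      · intro a' _ hne
        rw [pathMatrix, Matrix.of_apply, if_neg, zero_mul]
        rintro ⟨m', i', ha', hw'⟩
        obtain ⟨rfl, hi⟩ := hidx hw hw'
        obtain rfl : i = i' := by omega
        exact hne (Option.some.inj (ha'.symm.trans ha))
      · simp
    have h2 := hrow w
    rw [h1, hnostart w fun m' h => ?_, add_zero] at h2
    · exact sub_eq_zero.1 h2
    · have := (hidx hw (h ▸ hhead m')).2
      omega
  have honpath : ∀ m (i : ℕ) a, (P m)[i]? = some a → y a = 0 := by
    intro m i a ha
    have hconst : ∀ n b, (P m)[i + n]? = some b → y b = y a := by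
      intro n
      induction n with
      | zero => intro b hb; rw [Option.some.inj (hb.symm.trans ha)]
      | succ n ih =>
        intro b hb
        obtain ⟨hlt, -⟩ := List.getElem?_eq_some_iff.1 hb
        have hc : (P m)[i + n]? = some ((P m)[i + n]'(by omega)) := List.getElem?_eq_getElem _
        rw [← ih _ hc]
        exact hsucc m (i + n) _ b hc hb
    obtain ⟨hlt, -⟩ := List.getElem?_eq_some_iff.1 ha
    rw [← hconst ((P m).length - 1 - i) (v m)
      (by rw [← hlast m]; congr 1; omega), ← hf m]
    exact hend _
  have hy : y = 0 := by
    funext w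
    by_cases hw : ∃ m, ∃ i : ℕ, (P m)[i]? = some w
    · obtain ⟨m, i, h⟩ := hw
      exact honpath m i w h
    · push Not at hw
      have h2 := hrow w
      rw [hnostart w fun m h => hw m 0 (h ▸ hhead m), Finset.sum_eq_zero, sub_zero,
        add_zero] at h2
      · exact h2
      · intro a _
        rw [pathMatrix, Matrix.of_apply, if_neg, zero_mul]
        rintro ⟨m, i, -, h⟩
        exact hw m _ h
  have hz : z = 0 := by
    funext k
    obtain ⟨m, rfl⟩ := hssurj k
    have h2 := hrow (u m)
    rw [Finset.sum_eq_single (s m)] at h2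
    · simpa [hy, hs m] using h2
    · intro k' _ hne
      obtain ⟨m', rfl⟩ := hssurj k'
      refine if_neg fun h => hne ?_
      rw [(hidx (hhead m') ((hhead m).trans (by rw [h, hs m']))).1]
    · simp
  rw [hy, hz]
  ext (_ | _) <;> rfl

/-- The converse of `hasVertexDisjointPaths_of_minor_ne_zero`, up to the choice of the matrix
supported by the graph. -/
theorem exists_det_borderedMatrix_ne_zero {adj : V → V → Prop} {start fin : K → V}
    (h : HasVertexDisjointPaths adj (Set.range start) (Set.range fin) (Fintype.card K)) :
    ∃ G : Matrix V V ℂ, (∀ v w, G w v ≠ 0 → adj v w) ∧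
      (borderedMatrix G start fin).det ≠ 0 := by
  obtain ⟨P, hP, hdisj⟩ := h
  refine ⟨pathMatrix P, fun v w hne => ?_, det_borderedMatrix_pathMatrix_ne_zero hP hdisj⟩
  simp only [pathMatrix, Matrix.of_apply, ne_eq, ite_eq_right_iff, one_ne_zero, imp_false,
    not_not] at hne
  obtain ⟨m, i, hi, hw⟩ := hne
  obtain ⟨_, _, _, _, hpath⟩ := hP m
  obtain ⟨h1, rfl⟩ := List.getElem?_eq_some_iff.1 hi
  obtain ⟨h2, rfl⟩ := List.getElem?_eq_some_iff.1 hw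
  exact List.isChain_iff_getElem.1 hpath.1 i h2

theorem hasVertexDisjointPaths_one_iff {V : Type*} {adj : V → V → Prop} {u v : V} :
    HasVertexDisjointPaths adj (Set.range fun _ : Unit => u) (Set.range fun _ : Unit => v)
      (Fintype.card Unit) ↔ ∃ p, IsDirectedPath adj p u v := by
  constructor
  · rintro ⟨P, hP, -⟩
    obtain ⟨_, ⟨_, rfl⟩, _, ⟨_, rfl⟩, h⟩ := hP ⟨0, by simp⟩
    exact ⟨_, h⟩
  · rintro ⟨p, hp⟩
    refine ⟨fun _ => p, fun _ => ⟨u, ⟨(), rfl⟩, v, ⟨(), rfl⟩, hp⟩, fun m m' hne => ?_⟩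
    exact absurd (Subsingleton.elim (α := Fin 1) m m') hne

theorem closedLoopMinor_unit (G : Matrix V V ℂ) (u v : V) :
    closedLoopMinor G (fun _ : Unit => u) (fun _ => v) = closedLoop G v u := by
  simp [closedLoopMinor]

end Minors

/-! ### Genericity of network matrices -/

namespace Network

variable {V : Type*} [DecidableEq V] (N : Network V)

/-- The network matrix as a function of all its parameters. -/
def paramMatrix (x : N.known ⊕ N.unknown → ℂ) : Matrix V V ℂ :=
  N.netMatrix (x ∘ Sum.inl) (x ∘ Sum.inr)

theorem adj_of_netMatrix_ne_zero {g₀ : N.known → ℂ} {g : N.unknown → ℂ} (v w : V)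
    (h : N.netMatrix g₀ g w v ≠ 0) : N.Adj v w := by
  by_contra hne
  rw [Adj, not_or] at hne
  exact h (by simp [netMatrix, edgeMatrix, hne.1, hne.2])

theorem exists_paramMatrix_eq {G : Matrix V V ℂ} (h : ∀ v w, G w v ≠ 0 → N.Adj v w) :
    ∃ x, N.paramMatrix x = G := by
  refine ⟨Sum.elim (fun α => G α.1.2 α.1.1) fun α => G α.1.2 α.1.1, ?_⟩
  ext w v
  by_cases h₁ : (v, w) ∈ N.known
  · have h₂ : (v, w) ∉ N.unknown := Finset.disjoint_left.1 N.disjoint_known_unknown h₁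
    simp [paramMatrix, netMatrix, edgeMatrix, h₁, h₂]
  · by_cases h₂ : (v, w) ∈ N.unknown
    · simp [paramMatrix, netMatrix, edgeMatrix, h₁, h₂]
    · have : G w v = 0 := by
        by_contra hne
        exact (h v w hne).elim h₁ h₂
      simp [paramMatrix, netMatrix, edgeMatrix, h₁, h₂, this]

theorem exists_polynomial_one_sub_paramMatrix (i j : V) :
    ∃ p : MvPolynomial (N.known ⊕ N.unknown) ℂ,
      ∀ x, MvPolynomial.eval x p = (1 - N.paramMatrix x) i j := by
  refine ⟨MvPolynomial.C ((1 : Matrix V V ℂ) i j) -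
    ((if h : (j, i) ∈ N.known then MvPolynomial.X (Sum.inl ⟨(j, i), h⟩) else 0) +
      if h : (j, i) ∈ N.unknown then MvPolynomial.X (Sum.inr ⟨(j, i), h⟩) else 0), fun x => ?_⟩
  simp only [paramMatrix, netMatrix, edgeMatrix, Matrix.sub_apply, Matrix.add_apply,
    Matrix.of_apply, map_sub, map_add, MvPolynomial.eval_C]
  split_ifs <;> simp

/-- Generic properties of single network matrices hold generically for the two members of a pair
sharing its known entries. -/
theorem forAlmostAll_pair {P Q : Matrix V V ℂ → Prop}
    (hP : ForAlmostAll fun x => P (N.paramMatrix x))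
    (hQ : ForAlmostAll fun x => Q (N.paramMatrix x)) :
    ForAlmostAll fun z : N.known ⊕ (N.unknown ⊕ N.unknown) → ℂ =>
      P (N.netMatrix (fun α => z (Sum.inl α)) fun α => z (Sum.inr (Sum.inl α))) ∧
      Q (N.netMatrix (fun α => z (Sum.inl α)) fun α => z (Sum.inr (Sum.inr α))) :=
  ForAlmostAll.and
    (hP.comp_injective (f := Sum.map id Sum.inl)
      (Function.injective_id.sumMap Sum.inl_injective))
    (hQ.comp_injective (f := Sum.map id Sum.inr)
      (Function.injective_id.sumMap Sum.inr_injective))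

variable [Fintype V]

theorem forAlmostAll_wellPosed : ForAlmostAll fun x => WellPosed (N.paramMatrix x) := by
  have hzero : N.paramMatrix 0 = 0 := by
    ext i j
    simp [paramMatrix, netMatrix, edgeMatrix]
  refine (ForAlmostAll.det_ne_zero (F := fun x => 1 - N.paramMatrix x) (x₀ := 0)
    N.exists_polynomial_one_sub_paramMatrix (by simp [hzero])).mono fun x hx => ?_
  exact (Matrix.isUnit_iff_isUnit_det _).2 (isUnit_iff_ne_zero.2 hx)

theorem forAlmostAll_closedLoopMinor_ne_zero {K : Type*} [Fintype K] [DecidableEq K]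
    {start fin : K → V} (h : HasVertexDisjointPaths N.Adj (Set.range start) (Set.range fin)
      (Fintype.card K)) :
    ForAlmostAll fun x => closedLoopMinor (N.paramMatrix x) start fin ≠ 0 := by
  obtain ⟨G, hG, hdet⟩ := exists_det_borderedMatrix_ne_zero h
  obtain ⟨x₀, rfl⟩ := N.exists_paramMatrix_eq hG
  have hpoly : ∀ i j, ∃ p : MvPolynomial (N.known ⊕ N.unknown) ℂ,
      ∀ x, MvPolynomial.eval x p = borderedMatrix (N.paramMatrix x) start fin i j := by
    rintro (v | k) (w | k')
    · exact N.exists_polynomial_one_sub_paramMatrix v w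
    · exact ⟨MvPolynomial.C (if v = start k' then 1 else 0), fun x => by simp [borderedMatrix]⟩
    · exact ⟨MvPolynomial.C (if w = fin k then 1 else 0), fun x => by simp [borderedMatrix]⟩
    · exact ⟨0, fun x => by simp [borderedMatrix]⟩
  exact ((ForAlmostAll.det_ne_zero hpoly hdet).and N.forAlmostAll_wellPosed).mono
    fun x hx => (closedLoopMinor_ne_zero_iff hx.2 _ _).2 hx.1

theorem forAlmostAll_closedLoop_ne_zero {u v : V} (h : ∃ p, IsDirectedPath N.Adj p u v) :
    ForAlmostAll fun x => closedLoop (N.paramMatrix x) v u ≠ 0 := by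
  simpa only [closedLoopMinor_unit] using
    N.forAlmostAll_closedLoopMinor_ne_zero (hasVertexDisjointPaths_one_iff.2 h)

theorem exists_path_of_closedLoop_ne_zero {G : Matrix V V ℂ} (hG : WellPosed G)
    (hadj : ∀ v w, G w v ≠ 0 → N.Adj v w) {u v : V} (h : closedLoop G v u ≠ 0) :
    ∃ p, IsDirectedPath N.Adj p u v := by
  rw [← closedLoopMinor_unit] at h
  exact hasVertexDisjointPaths_one_iff.1 (hasVertexDisjointPaths_of_minor_ne_zero hG hadj h)

end Network

/-! ### Decoupled identifiability as the nonvanishing of a determinant -/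

theorem mul_edgeMatrix_mul_apply {V : Type*} [Fintype V] [DecidableEq V] (S : Finset (V × V))
    (x : S → ℂ) (X Y : Matrix V V ℂ) (c b : V) :
    (X * edgeMatrix S x * Y) c b = ∑ α : S, X c α.1.2 * Y α.1.1 b * x α := by
  let f : V × V → ℂ := fun p => X c p.2 * edgeMatrix S x p.2 p.1 * Y p.1 b
  have h₁ : (X * edgeMatrix S x * Y) c b = ∑ p, f p := by
    simp only [Matrix.mul_apply, Finset.sum_mul, Fintype.sum_prod_type, f]
  have h₂ : ∑ p ∈ S, f p = ∑ p, f p := by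
    refine Finset.sum_subset (Finset.subset_univ S) fun p _ hp => ?_
    simp [f, edgeMatrix, hp]
  rw [h₁, ← h₂, ← Finset.sum_coe_sort]
  refine Finset.sum_congr rfl fun α _ => ?_
  simp only [f, edgeMatrix, Matrix.of_apply, Prod.mk.eta, dif_pos α.2, Subtype.coe_eta]
  ring

namespace Network

variable {V : Type*} [Fintype V] [DecidableEq V] (N : Network V)

/-- The transfer from the end node of each unknown edge to each measured node. -/
noncomputable def edgeToMeasured (G : Matrix V V ℂ) : N.measured → N.unknown → ℂ :=
  fun c α => closedLoop G c α.1.2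

/-- The transfer from each excited node to the start node of each unknown edge. -/
noncomputable def excitedToEdge (G : Matrix V V ℂ) : N.unknown → N.excited → ℂ :=
  fun α b => closedLoop G α.1.1 b

theorem measurement_mul_mul_excitation_apply (X : Matrix V V ℂ) (c : N.measured)
    (b : N.excited) : (N.measurementMatrix * X * N.excitationMatrix) c b = X c b := by
  simp [Matrix.mul_apply, measurementMatrix, excitationMatrix]

theorem decoupledIdentifiableAt_iff (G G' : Matrix V V ℂ) (e : N.unknown ≃ N.measured × N.excited) :
    N.DecoupledIdentifiableAt G G' ↔ WellPosed G ∧ WellPosed G' ∧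
      (columnKronecker (N.edgeToMeasured G) (N.excitedToEdge G') e).det ≠ 0 := by
  refine and_congr_right fun _ => and_congr_right fun _ => ?_
  have hsupp : ∀ (x : N.unknown → ℂ) i j, (j, i) ∉ N.unknown → edgeMatrix N.unknown x i j = 0 :=
    fun x i j h => dif_neg h
  have hentry : ∀ (x : N.unknown → ℂ) l,
      (N.measurementMatrix * closedLoop G * edgeMatrix N.unknown x * closedLoop G' *
        N.excitationMatrix) (e l).1 (e l).2 =
      (columnKronecker (N.edgeToMeasured G) (N.excitedToEdge G') e *ᵥ x) l := by
    intro x l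
    rw [Matrix.mul_assoc N.measurementMatrix, Matrix.mul_assoc N.measurementMatrix,
      measurement_mul_mul_excitation_apply, mul_edgeMatrix_mul_apply]
    rfl
  have hkernel : ∀ x : N.unknown → ℂ,
      N.measurementMatrix * closedLoop G * edgeMatrix N.unknown x * closedLoop G' *
        N.excitationMatrix = 0 ↔
      columnKronecker (N.edgeToMeasured G) (N.excitedToEdge G') e *ᵥ x = 0 := by
    intro x
    constructor
    · intro h
      funext l
      rw [← hentry, h]
      rfl
    · intro h
      ext c b
      have := hentry x (e.symm (c, b))
      rw [h, e.apply_symm_apply] at this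
      exact this
  constructor
  · intro h hdet
    obtain ⟨x, hx0, hx⟩ := Matrix.exists_mulVec_eq_zero_iff.2 hdet
    have hzero := h _ (hsupp x) ((hkernel x).2 hx)
    refine hx0 (funext fun α => ?_)
    have := congrFun (congrFun hzero α.1.2) α.1.1
    simpa only [edgeMatrix, Matrix.of_apply, Prod.mk.eta, dif_pos α.2, Subtype.coe_eta,
      Matrix.zero_apply, Pi.zero_apply] using this
  · intro hdet Δ hΔ h
    have hΔx : Δ = edgeMatrix N.unknown fun α => Δ α.1.2 α.1.1 := by
      ext i j
      by_cases hij : (j, i) ∈ N.unknown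
      · simp [edgeMatrix, hij]
      · rw [hΔ i j hij, hsupp _ i j hij]
    rw [hΔx] at h
    have hx : (fun α : N.unknown => Δ α.1.2 α.1.1) = 0 := by
      by_contra hne
      exact hdet (Matrix.exists_mulVec_eq_zero_iff.1 ⟨_, hne, (hkernel _).1 h⟩)
    rw [hΔx, hx]
    ext i j
    simp [edgeMatrix]

/-- Exchanging the roles of excitations and measurements in the expansion does not change the
determinant. -/
theorem columnKronecker_swap (G G' : Matrix V V ℂ) (e : N.unknown ≃ N.measured × N.excited) :
    columnKronecker (fun b α => N.excitedToEdge G' α b) (fun α c => N.edgeToMeasured G c α)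
      (e.trans (Equiv.prodComm _ _)) =
    columnKronecker (N.edgeToMeasured G) (N.excitedToEdge G') e := by
  ext l α
  exact mul_comm _ _

/-- If generic properties `P` of `G` and `Q` of `G'` force the determinant governing identifiability
to be nonzero, then the network is generically identifiable for almost all known entries. -/
theorem forAlmostAll_genericallyDecoupledIdentifiable
    (e : N.unknown ≃ N.measured × N.excited) {P Q : Matrix V V ℂ → Prop}
    (hP : ForAlmostAll fun x => P (N.paramMatrix x))
    (hQ : ForAlmostAll fun x => Q (N.paramMatrix x))
    (h : ∀ G G' : Matrix V V ℂ, WellPosed G → WellPosed G' →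
      (∀ v w, G w v ≠ 0 → N.Adj v w) → (∀ v w, G' w v ≠ 0 → N.Adj v w) → P G → Q G' →
      (columnKronecker (N.edgeToMeasured G) (N.excitedToEdge G') e).det ≠ 0) :
    ForAlmostAll fun g₀ : N.known → ℂ => N.GenericallyDecoupledIdentifiable g₀ := by
  have key := N.forAlmostAll_pair (P := fun G => P G ∧ WellPosed G)
    (Q := fun G' => Q G' ∧ WellPosed G') (hP.and N.forAlmostAll_wellPosed)
    (hQ.and N.forAlmostAll_wellPosed)
  refine (key.mono (Q := fun z => N.DecoupledIdentifiableAt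
    (N.netMatrix (fun α => z (Sum.inl α)) fun α => z (Sum.inr (Sum.inl α)))
    (N.netMatrix (fun α => z (Sum.inl α)) fun α => z (Sum.inr (Sum.inr α)))) ?_).curry
  rintro z ⟨⟨hP, hG⟩, hQ, hG'⟩
  exact (N.decoupledIdentifiableAt_iff _ _ e).2 ⟨hG, hG',
    h _ _ hG hG' N.adj_of_netMatrix_ne_zero N.adj_of_netMatrix_ne_zero hP hQ⟩

end Network

/-! ### Assignations and nonvanishing terms -/

theorem card_fiber_snd {Λ I J : Type*} (τ : Λ ≃ I × J) (b : J) :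
    Nat.card {α // (τ α).2 = b} = Nat.card I := by
  refine Nat.card_congr ⟨fun α => (τ α.1).1, fun i => ⟨τ.symm (i, b), by simp⟩, ?_, ?_⟩
  · rintro ⟨α, rfl⟩
    simp
  · intro i
    simp

theorem exists_equiv_of_card_fiber {Λ I J : Type*} [Finite Λ] [Finite I] {σ : Λ → J}
    (h : ∀ b, Nat.card {α // σ α = b} = Nat.card I) : ∃ τ : Λ ≃ I × J, ∀ α, (τ α).2 = σ α :=
  ⟨(Equiv.sigmaFiberEquiv σ).symm.trans
    ((Equiv.sigmaCongrRight fun b => Classical.choice (Finite.card_eq.1 (h b))).trans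
      ((Equiv.sigmaEquivProd J I).trans (Equiv.prodComm J I))), fun _ => rfl⟩

theorem range_symm_prodMk {Λ I J V : Type*} (τ : Λ ≃ I × J) (b : J) (g : Λ → V) :
    Set.range (fun i => g (τ.symm (i, b))) = {v | ∃ α, (τ α).2 = b ∧ g α = v} := by
  ext v
  constructor
  · rintro ⟨i, rfl⟩
    exact ⟨_, by simp, rfl⟩
  · rintro ⟨α, rfl, rfl⟩
    exact ⟨(τ α).1, by simp⟩

namespace Network

variable {V : Type*} [Fintype V] [DecidableEq V] {N : Network V}

theorem isExcitationAssignation_of_isNonvanishingTerm {G G' : Matrix V V ℂ} (hG : WellPosed G)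
    (hG' : WellPosed G') (hadj : ∀ v w, G w v ≠ 0 → N.Adj v w)
    (hadj' : ∀ v w, G' w v ≠ 0 → N.Adj v w) {τ : N.unknown ≃ N.measured × N.excited}
    (hτ : IsNonvanishingTerm (N.edgeToMeasured G) (N.excitedToEdge G') τ) :
    N.IsExcitationAssignation fun α => (τ α).2 where
  card_fiber b := (card_fiber_snd τ b).trans (by simp)
  connected α := N.exists_path_of_closedLoop_ne_zero hG' hadj' (hτ.1 α)
  disjoint_paths b := by
    have := hasVertexDisjointPaths_of_minor_ne_zero hG hadj
      (start := fun c => (τ.symm (c, b)).1.2) (fin := fun c : N.measured => (c : V)) (hτ.2 b)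
    rwa [range_symm_prodMk τ b fun α => α.1.2, Subtype.range_coe_subtype,
      Fintype.card_coe] at this

theorem isMeasurementAssignation_of_isNonvanishingTerm {G G' : Matrix V V ℂ} (hG : WellPosed G)
    (hG' : WellPosed G') (hadj : ∀ v w, G w v ≠ 0 → N.Adj v w)
    (hadj' : ∀ v w, G' w v ≠ 0 → N.Adj v w) {τ : N.unknown ≃ N.excited × N.measured}
    (hτ : IsNonvanishingTerm (fun b α => N.excitedToEdge G' α b)
      (fun α c => N.edgeToMeasured G c α) τ) :
    N.IsMeasurementAssignation fun α => (τ α).2 where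
  card_fiber c := (card_fiber_snd τ c).trans (by simp)
  connected α := N.exists_path_of_closedLoop_ne_zero hG hadj (hτ.1 α)
  disjoint_paths c := by
    have hdet := hτ.2 c
    rw [← Matrix.det_transpose] at hdet
    have := hasVertexDisjointPaths_of_minor_ne_zero hG' hadj'
      (start := fun b : N.excited => (b : V)) (fin := fun b => (τ.symm (b, c)).1.1) hdet
    rwa [range_symm_prodMk τ c fun α => α.1.1, Subtype.range_coe_subtype,
      Fintype.card_coe] at this

theorem forAlmostAll_of_unique_excitationAssignation (e : N.unknown ≃ N.measured × N.excited)
    {σ : N.unknown → N.excited} (hσ : N.IsExcitationAssignation σ)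
    (huniq : ∀ σ', N.IsExcitationAssignation σ' → σ' = σ) :
    ForAlmostAll fun g₀ : N.known → ℂ => N.GenericallyDecoupledIdentifiable g₀ := by
  obtain ⟨τ, hτ⟩ := exists_equiv_of_card_fiber (I := N.measured) (σ := σ) fun b => by
    rw [hσ.card_fiber b]
    simp
  obtain rfl : (fun α => (τ α).2) = σ := funext hτ
  refine N.forAlmostAll_genericallyDecoupledIdentifiable e
    (P := fun G => ∀ b, closedLoopMinor G (fun c => (τ.symm (c, b)).1.2)
      (fun c : N.measured => (c : V)) ≠ 0)
    (Q := fun G' => ∀ α, N.excitedToEdge G' α (τ α).2 ≠ 0)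
    (ForAlmostAll.forall_fintype fun b => N.forAlmostAll_closedLoopMinor_ne_zero ?_)
    (ForAlmostAll.forall_fintype fun α => N.forAlmostAll_closedLoop_ne_zero (hσ.connected α))
    fun G G' hG hG' hadj hadj' hP hQ => det_columnKronecker_ne_zero e ⟨hQ, hP⟩ fun τ' hτ' =>
      congrFun (huniq _ (isExcitationAssignation_of_isNonvanishingTerm hG hG' hadj hadj' hτ'))
  rw [range_symm_prodMk τ b fun α => α.1.2, Subtype.range_coe_subtype, Fintype.card_coe]
  exact hσ.disjoint_paths b

theorem forAlmostAll_of_unique_measurementAssignation (e : N.unknown ≃ N.measured × N.excited)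
    {σ : N.unknown → N.measured} (hσ : N.IsMeasurementAssignation σ)
    (huniq : ∀ σ', N.IsMeasurementAssignation σ' → σ' = σ) :
    ForAlmostAll fun g₀ : N.known → ℂ => N.GenericallyDecoupledIdentifiable g₀ := by
  obtain ⟨τ, hτ⟩ := exists_equiv_of_card_fiber (I := N.excited) (σ := σ) fun c => by
    rw [hσ.card_fiber c]
    simp
  obtain rfl : (fun α => (τ α).2) = σ := funext hτ
  refine N.forAlmostAll_genericallyDecoupledIdentifiable e
    (P := fun G => ∀ α, N.edgeToMeasured G (τ α).2 α ≠ 0)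
    (Q := fun G' => ∀ c, closedLoopMinor G' (fun b : N.excited => (b : V))
      (fun b => (τ.symm (b, c)).1.1) ≠ 0)
    (ForAlmostAll.forall_fintype fun α => N.forAlmostAll_closedLoop_ne_zero (hσ.connected α))
    (ForAlmostAll.forall_fintype fun c => N.forAlmostAll_closedLoopMinor_ne_zero ?_)
    fun G G' hG hG' hadj hadj' hP hQ => ?_
  · rw [range_symm_prodMk τ c fun α => α.1.1, Subtype.range_coe_subtype, Fintype.card_coe]
    exact hσ.disjoint_paths c
  · rw [← N.columnKronecker_swap G G' e]
    refine det_columnKronecker_ne_zero _ (τ := τ) ⟨hP, fun c => ?_⟩ fun τ' hτ' =>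
      congrFun (huniq _ (isMeasurementAssignation_of_isNonvanishingTerm hG hG' hadj hadj' hτ'))
    rw [← Matrix.det_transpose]
    exact hQ c

end Network

theorem lemma2 {V : Type*} [Fintype V] [DecidableEq V] (N : Network V)
    (hcard : N.unknown.card = N.excited.card * N.measured.card) :
    -- necessity, whatever the values of the known transfer functions
    (∀ g₀ : N.known → ℂ, N.GenericallyDecoupledIdentifiable g₀ →
      (∃ σB : N.unknown → N.excited, N.IsExcitationAssignation σB) ∧
      (∃ σC : N.unknown → N.measured, N.IsMeasurementAssignation σC)) ∧
    -- sufficiency, for almost all values of the known transfer functions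
    ((∃! σB : N.unknown → N.excited, N.IsExcitationAssignation σB) →
      ForAlmostAll fun g₀ : N.known → ℂ => N.GenericallyDecoupledIdentifiable g₀) ∧
    ((∃! σC : N.unknown → N.measured, N.IsMeasurementAssignation σC) →
      ForAlmostAll fun g₀ : N.known → ℂ => N.GenericallyDecoupledIdentifiable g₀) := by
  obtain ⟨e⟩ : Nonempty (N.unknown ≃ N.measured × N.excited) :=
    Fintype.card_eq.1 (by simp [hcard, mul_comm])
  refine ⟨fun g₀ h => ?_, ?_, ?_⟩
  · obtain ⟨x, hx⟩ := h.exists_point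
    obtain ⟨hG, hG', hdet⟩ := (N.decoupledIdentifiableAt_iff _ _ e).1 hx
    constructor
    · obtain ⟨τ, hτ⟩ := exists_isNonvanishingTerm_of_det_ne_zero hdet
      exact ⟨_, Network.isExcitationAssignation_of_isNonvanishingTerm hG hG'
        N.adj_of_netMatrix_ne_zero N.adj_of_netMatrix_ne_zero hτ⟩
    · rw [← N.columnKronecker_swap] at hdet
      obtain ⟨τ, hτ⟩ := exists_isNonvanishingTerm_of_det_ne_zero hdet
      exact ⟨_, Network.isMeasurementAssignation_of_isNonvanishingTerm hG hG'
        N.adj_of_netMatrix_ne_zero N.adj_of_netMatrix_ne_zero hτ⟩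
  · rintro ⟨σ, hσ, huniq⟩
    exact Network.forAlmostAll_of_unique_excitationAssignation e hσ huniq
  · rintro ⟨σ, hσ, huniq⟩
    exact Network.forAlmostAll_of_unique_measurementAssignation e hσ huniq
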